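/- For $f : X\times Y\to\{0,1\}$ let $D(f)$ be the deterministic two-party communication complexity of $f$ (the least depth of a protocol tree that computes $f$), let $\mathrm{rank}(f)$ be the rank over $\mathbb{R}$ of the matrix $(f(x,y))_{x\in X,\,y\in Y}$, and let $Q^*(f)$ be the least number $\ell$ of rounds of a qubit protocol that computes $f$ exactly with prior entanglement: Alice and Bob initially share some finite number of EPR-pairs, all their other qubits and a one-qubit channel are $0$; in $\ell$ alternating rounds, starting with Alice, Alice applies a unitary depending on $x$ to her part and the channel, respectively Bob applies a unitary depending on $y$ to his part and the channel; at the end, for every $(x,y)$, measuring the channel yields $f(x,y)$ with probability $1$. There is an absolute constant $C>0$ such that for every $n\ge 0$ and every monotone (non-decreasing) $g:\{0,1\}^n\to\{0,1\}$, the function $f(x,y)=g(x\wedge y)$ on $\{0,1\}^n\times\{0,1\}^n$, where $x\wedge y$ is the bitwise AND, satisfies $$D(f)\le C\cdot\max\{1,(\log_2 \mathrm{rank}(f))^2\}\qquad\text{and}\qquad D(f)\le C\cdot Q^*(f)^2,$$ where $\log_2 0$ is read as $0$. That is, $D(f)\in O((\log \mathrm{rank}(f))^2)$ and $D(f)\in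 O(Q^*(f)^2)$. -/

import Mathlib

namespace CommComplexity

/-! ### Deterministic communication complexity -/

/-- A deterministic two-party communication protocol on inputs `x : X` (Alice) and `y : Y` (Bob),
as a binary tree. At an internal node one bit, computed by the owner of the node from her or his own
input, is sent to the other party; the protocol continues in the first subtree if the bit is `true`
and in the second one otherwise. At a leaf both parties know the output. -/
inductive Protocol (X Y : Type) : Type
  | leaf (out : Bool) : Protocol X Y
  | alice (bit : X → Bool) (ifTrue ifFalse : Protocol X Y) : Protocol X Y
  | bob (bit : Y → Bool) (ifTrue ifFalse : Protocol X Y) : Protocol X Y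

namespace Protocol

variable {X Y : Type}

/-- The output of the protocol on input `(x, y)`. -/
def eval : Protocol X Y → X → Y → Bool
  | leaf out, _, _ => out
  | alice bit P Q, x, y => bif bit x then P.eval x y else Q.eval x y
  | bob bit P Q, x, y => bif bit y then P.eval x y else Q.eval x y

/-- The worst-case number of bits sent: the depth of the tree. -/
def cost : Protocol X Y → ℕ
  | leaf _ => 0
  | alice _ P Q => max P.cost Q.cost + 1
  | bob _ P Q => max P.cost Q.cost + 1

/-- The protocol computes `f` on every input. -/
def Computes (P : Protocol X Y) (f : X → Y → Bool) : Prop :=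
  ∀ x y, P.eval x y = f x y

end Protocol

/-- `D(f)`: the least cost of a deterministic protocol that computes `f`. -/
noncomputable def D {X Y : Type} (f : X → Y → Bool) : ℕ :=
  sInf {d | ∃ P : Protocol X Y, P.Computes f ∧ P.cost = d}

/-- The infimum in the definition of `D` is over a nonempty set if `X` is finite. -/
theorem exists_protocol {X Y : Type} [Finite X] (f : X → Y → Bool) :
    ∃ P : Protocol X Y, P.Computes f := by
  classical
  have := Fintype.ofFinite X
  have key : ∀ S : Finset X, ∃ P : Protocol X Y, ∀ x ∈ S, ∀ y, P.eval x y = f x y := by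
    intro S
    induction S using Finset.induction_on with
    | empty => exact ⟨.leaf true, by simp⟩
    | insert a S _ ih =>
      obtain ⟨P, hP⟩ := ih
      refine ⟨.alice (fun x => decide (x = a)) (.bob (f a) (.leaf true) (.leaf false)) P, ?_⟩
      intro x hx y
      by_cases h : x = a
      · subst h
        cases hf : f x y <;> simp [Protocol.eval, hf]
      · have hxS : x ∈ S := by simpa [h] using hx
        simp [Protocol.eval, h, hP x hxS y]
  obtain ⟨P, hP⟩ := key Finset.univ
  exact ⟨P, fun x y => hP x (Finset.mem_univ x) y⟩

/-! ### Quantum communication complexity with prior entanglement -/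

/-- Computational basis states of `m` qubits. -/
abbrev Bits (m : ℕ) : Type := Fin m → Bool

/-- Basis states of one party's part: the halves of `k` EPR-pairs, and `a` further qubits. -/
abbrev Reg (k a : ℕ) : Type := Bits k × Bits a

/-- Amplitudes of a state on (Alice's part) ⊗ (the one-qubit channel) ⊗ (Bob's part). -/
abbrev State (k a b : ℕ) : Type := Reg k a × Bool × Reg k b → ℂ

/-- A qubit protocol with prior entanglement. Alice and Bob share `epr` EPR-pairs and have `anc₁`
and `anc₂` further qubits. In rounds `0, 2, 4, …` Alice applies a unitary that depends on her input
and on the round to her part and the channel; in rounds `1, 3, 5, …` Bob does the same with his part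
and the channel. One qubit is sent in each round, and there are `rounds` rounds. (The values of
`alice` at odd rounds, those of `bob` at even rounds, and those beyond the last round are not
used.) -/
structure QProtocol (X Y : Type) where
  epr : ℕ
  anc₁ : ℕ
  anc₂ : ℕ
  rounds : ℕ
  alice : ℕ → X → Matrix.unitaryGroup (Reg epr anc₁ × Bool) ℂ
  bob : ℕ → Y → Matrix.unitaryGroup (Bool × Reg epr anc₂) ℂ

/-- The initial state: `k` EPR-pairs `(|00⟩ + |11⟩) / √2` shared between Alice and Bob, all other
qubits (the channel included) being zero. -/
noncomputable def initState (k a b : ℕ) : State k a b := fun p =>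
  if p.1.1 = p.2.2.1 ∧ p.1.2 = (fun _ => false) ∧ p.2.1 = false ∧ p.2.2.2 = (fun _ => false)
  then (((Real.sqrt 2)⁻¹ : ℝ) : ℂ) ^ k else 0

/-- `U ⊗ I` with `U` acting on Alice's part and the channel. -/
noncomputable def applyAlice {k a b : ℕ} (U : Matrix (Reg k a × Bool) (Reg k a × Bool) ℂ)
    (ψ : State k a b) : State k a b := fun p =>
  U.mulVec (fun q => ψ (q.1, q.2, p.2.2)) (p.1, p.2.1)

/-- `I ⊗ U` with `U` acting on the channel and Bob's part. -/
noncomputable def applyBob {k a b : ℕ} (U : Matrix (Bool × Reg k b) (Bool × Reg k b) ℂ)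
    (ψ : State k a b) : State k a b := fun p =>
  U.mulVec (fun q => ψ (p.1, q)) p.2

/-- The state after the first `i` rounds, when Alice applies `U j` in the even rounds `j` and Bob
applies `V j` in the odd rounds `j`. -/
noncomputable def evolve {k a b : ℕ} (U : ℕ → Matrix.unitaryGroup (Reg k a × Bool) ℂ)
    (V : ℕ → Matrix.unitaryGroup (Bool × Reg k b) ℂ) : ℕ → State k a b
  | 0 => initState k a b
  | i + 1 =>
      if Even i then applyAlice (U i).1 (evolve U V i) else applyBob (V i).1 (evolve U V i)

namespace QProtocol

variable {X Y : Type}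

/-- The final state on input `(x, y)`. -/
noncomputable def finalState (π : QProtocol X Y) (x : X) (y : Y) :
    State π.epr π.anc₁ π.anc₂ :=
  evolve (fun i => π.alice i x) (fun i => π.bob i y) π.rounds

/-- The probability that measuring the channel at the end of the protocol yields `c`. -/
noncomputable def outputProb (π : QProtocol X Y) (x : X) (y : Y) (c : Bool) : ℝ :=
  ∑ r : Reg π.epr π.anc₁, ∑ s : Reg π.epr π.anc₂, ‖π.finalState x y (r, c, s)‖ ^ 2

/-- The protocol computes `f` exactly: on every input, the output bit on the channel is correct with
probability `1`. -/
def Computes (π : QProtocol X Y) (f : X → Y → Bool) : Prop :=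
  ∀ x y, π.outputProb x y (f x y) = 1

end QProtocol

/-- `Q*(f)`: the least number of qubits sent by a protocol that computes `f` exactly and may use any
finite number of shared EPR-pairs. -/
noncomputable def Qstar {X Y : Type} (f : X → Y → Bool) : ℕ :=
  sInf {l | ∃ π : QProtocol X Y, π.Computes f ∧ π.rounds = l}

/-- The permutation matrix of an involution of the basis states, as a unitary. -/
noncomputable def involutionUnitary {ι : Type} [Fintype ι] [DecidableEq ι] (σ : ι → ι)
    (hσ : ∀ p, σ (σ p) = p) : Matrix.unitaryGroup ι ℂ :=
  ⟨Matrix.of fun p q => if σ p = q then 1 else 0, by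
    rw [Matrix.mem_unitaryGroup_iff]
    ext p q
    simp [Matrix.mul_apply, Matrix.star_apply, Matrix.one_apply, (Function.Involutive.injective hσ).eq_iff, eq_comm]⟩

theorem involutionUnitary_mulVec {ι : Type} [Fintype ι] [DecidableEq ι] (σ : ι → ι)
    (hσ : ∀ p, σ (σ p) = p) (v : ι → ℂ) :
    (involutionUnitary σ hσ).1.mulVec v = fun p => v (σ p) := by
  ext p
  simp [involutionUnitary, Matrix.mulVec, dotProduct]

/-- Alice sends her input bit by bit. -/
noncomputable def sendBits {n : ℕ} (x : Bits n) (i : ℕ) :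
    Matrix.unitaryGroup (Reg 0 0 × Bool) ℂ :=
  involutionUnitary (fun p => (p.1, p.2 ^^ (if h : i / 2 < n then x ⟨i / 2, h⟩ else false)))
    (fun p => by simp)

/-- Bob collects `n` bits and then puts the value of `h` on them on the channel. -/
noncomputable def collectBits {n : ℕ} (h : Bits n → Bool) (i : ℕ) :
    Matrix.unitaryGroup (Bool × Reg 0 n) ℂ :=
  if hi : i / 2 < n then
    involutionUnitary
      (fun p => (p.2.2 ⟨i / 2, hi⟩, p.2.1, Function.update p.2.2 ⟨i / 2, hi⟩ p.1))
      (fun p => by simp)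
  else involutionUnitary (fun p => (p.1 ^^ h p.2.2, p.2)) (fun p => by simp)

theorem evolve_send_collect {n : ℕ} (h : Bits n → Bool) (x : Bits n)
    (i : ℕ) (hi : i ≤ n) (r : Reg 0 0) (c : Bool) (s : Reg 0 n) :
    evolve (sendBits x) (collectBits h) (2 * i) (r, c, s) =
      if c = false ∧ s.2 = (fun j => decide (j.1 < i) && x j) then 1 else 0 := by
  induction i generalizing r c s with
  | zero =>
    have h1 : r.1 = s.1 := Subsingleton.elim _ _
    have h2 : r.2 = fun _ => false := Subsingleton.elim _ _
    simp [evolve, initState, h1, h2]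
  | succ i ih =>
    have hlt : i < n := hi
    have e1 : (2 * i + 1) / 2 = i := by omega
    have e2 : (2 * i) / 2 = i := by omega
    have e3 : ¬ Even (2 * i + 1) := by simp
    have e4 : Even (2 * i) := by simp
    have hb : collectBits h (2 * i + 1) = involutionUnitary
        (fun p => (p.2.2 ⟨i, hlt⟩, p.2.1, Function.update p.2.2 ⟨i, hlt⟩ p.1))
        (fun p => by simp) := by
      simp [collectBits, e1, hlt]
    have ha : sendBits x (2 * i) = involutionUnitary
        (fun p => (p.1, p.2 ^^ x ⟨i, hlt⟩)) (fun p => by simp) := by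
      simp [sendBits, e2, hlt]
    rw [show 2 * (i + 1) = (2 * i + 1) + 1 by ring, evolve, if_neg e3, evolve,
      if_pos e4, hb, ha]
    simp only [applyBob, applyAlice, involutionUnitary_mulVec]
    rw [ih (by omega)]
    congr 1
    rw [eq_iff_iff]
    constructor
    · rintro ⟨h1, h2⟩
      have hc := congrFun h2 ⟨i, hlt⟩
      simp at hc
      refine ⟨hc, ?_⟩
      funext j
      have hj := congrFun h2 j
      by_cases h : j = ⟨i, hlt⟩
      · subst h
        simp at h1
        simp [h1]
      · have : j.1 ≠ i := fun h' => h (Fin.ext h')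
        simp only [Function.update_of_ne h] at hj
        rw [hj]
        congr 2
        simp
        omega
    · rintro ⟨h1, h2⟩
      refine ⟨by simp [h2], ?_⟩
      funext j
      by_cases h : j = ⟨i, hlt⟩
      · subst h
        simp [h1]
      · have : j.1 ≠ i := fun h' => h (Fin.ext h')
        simp only [Function.update_of_ne h, h2]
        congr 2
        simp
        omega

/-- The infimum in the definition of `Qstar` is over a nonempty set if Alice's inputs are bit
strings. -/
theorem exists_qProtocol {n : ℕ} {Y : Type} (f : Bits n → Y → Bool) :
    ∃ π : QProtocol (Bits n) Y, π.Computes f := by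
  refine ⟨⟨0, 0, n, 2 * n + 2, fun i x => sendBits x i,
    fun i y => collectBits (fun x => f x y) i⟩, fun x y => ?_⟩
  have e1 : (2 * n + 1) / 2 = n := by omega
  have e2 : (2 * n) / 2 = n := by omega
  have e3 : ¬ Even (2 * n + 1) := by simp
  have e4 : Even (2 * n) := by simp
  have hb : collectBits (fun x => f x y) (2 * n + 1) = involutionUnitary
      (fun p => (p.1 ^^ f p.2.2 y, p.2)) (fun p => by simp) := by
    simp [collectBits, e1]
  have ha : sendBits x (2 * n) = involutionUnitary
      (fun p => (p.1, p.2 ^^ false)) (fun p => by simp) := by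
    simp [sendBits, e2]
  have key : ∀ (r : Reg 0 0) (s : Reg 0 n),
      evolve (sendBits x) (collectBits (fun x => f x y)) (2 * n + 2) (r, f x y, s) =
        if s.2 = x then 1 else 0 := by
    intro r s
    rw [evolve, if_neg e3, evolve, if_pos e4, hb, ha]
    simp only [applyBob, applyAlice, involutionUnitary_mulVec]
    rw [evolve_send_collect _ x n le_rfl]
    congr 1
    simp
    intro hs
    rw [hs]
  change ∑ r : Reg 0 0, ∑ s : Reg 0 n,
    ‖evolve (sendBits x) (collectBits (fun x => f x y)) (2 * n + 2) (r, f x y, s)‖ ^ 2 = 1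
  have h2 : ∀ s : Reg 0 n, ‖(if s.2 = x then 1 else 0 : ℂ)‖ ^ 2 = if s.2 = x then 1 else 0 := by
    intro s; split_ifs <;> simp
  simp_rw [key, h2]
  rw [Finset.sum_const, Fintype.sum_prod_type]
  simp

/-! ### The rank and the functions `g(x ∧ y)` -/

/-- `rank(f)`: the rank over the reals of the communication matrix `M_f`, whose `(x, y)` entry is
`f(x, y)`. -/
noncomputable def rank {X Y : Type} [Fintype Y] (f : X → Y → Bool) : ℕ :=
  (Matrix.of fun x y => if f x y then (1 : ℝ) else 0).rank

/-- The function `f(x, y) = g(x ∧ y)`, where `x ∧ y` is the bitwise AND. -/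
def andFun {n : ℕ} (g : (Fin n → Bool) → Bool) (x y : Fin n → Bool) : Bool :=
  g (fun i => x i && y i)

end CommComplexity

/-! Both bounds pass through the rank $r$ of $f$. Since $g$ is monotone, the ones of $f$ are covered
by the rectangles $\{x\ge z\}\times\{y\ge z\}$, with $z$ running over the minterms of $g$. The
submatrix of $f$ indexed by minterms is an identity matrix, so there are at most $r$ such rectangles
(`card_minterm_le_rank`).

Such a cover gives a protocol (`exists_protocol_of_cover`). Each rectangle is a zero block of the
complement of $f$, a matrix of rank at most $r+1$. By `finrank_rowSpan_add_le`, keeping only the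
rows of the block or only its columns halves the rank. Naming a rectangle costs about $\log r$ bits
and this happens about $\log r$ times, whence $D(f)=O((\log r)^2)$.

For $Q^*$ it suffices that an exact protocol with $\ell$ rounds gives $r\le 4^\ell$
(`QProtocol.rank_le`). By exactness, projecting the final state onto channel value $1$ multiplies it
by $f(x,y)$. Undoing all rounds then yields $f(x,y)$ times the initial state, as a sum of
$2^\ell\cdot 2^\ell$ product operators applied to the maximally entangled state. Read as matrices,
$f(x,y)\,I_d=\sum_w P_w(x)Q_w(y)$ with $4^\ell$ terms. Thus $M_f\otimes I_d$ has rank at most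
$4^\ell d$, and the entanglement dimension $d$ cancels. -/

namespace CommComplexity

/-! ### Choosing among protocols -/

/-- Alice announces `h x`, one of at most `2 ^ k` values, at a cost of `k` bits. -/
theorem exists_aliceChoose {X Y ι : Type} (h : X → ι) (P : ι → Protocol X Y) (c : ℕ)
    (hc : ∀ i, (P i).cost ≤ c) (k : ℕ) (s : Finset ι) (hs : s.Nonempty) (hk : s.card ≤ 2 ^ k) :
    ∃ R : Protocol X Y, R.cost ≤ k + c ∧ ∀ x y, h x ∈ s → R.eval x y = (P (h x)).eval x y := by
  classical
  induction k generalizing s with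
  | zero =>
    obtain ⟨i, hi⟩ := hs
    refine ⟨P i, by simpa using hc i, fun x y hx => ?_⟩
    rw [Finset.card_le_one.1 (by simpa using hk) _ hx _ hi]
  | succ k ih =>
    by_cases hsmall : s.card ≤ 2 ^ k
    · obtain ⟨R, hR, hR'⟩ := ih s hs hsmall
      exact ⟨R, by omega, hR'⟩
    -- As `s` has more than `2 ^ k` and at most `2 ^ (k + 1)` elements, `t` and `s \ t` are both
    -- nonempty and of size at most `2 ^ k`.
    obtain ⟨t, hts, htc⟩ := Finset.exists_subset_card_eq (s := s) (n := 2 ^ k) (by omega)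
    have h1 : (s \ t).card = s.card - t.card := Finset.card_sdiff_of_subset hts
    have h2 : 0 < 2 ^ k := by positivity
    have h3 : 2 ^ (k + 1) = 2 ^ k + 2 ^ k := by ring
    obtain ⟨R₁, hc₁, hR₁⟩ := ih t (Finset.card_pos.1 (by omega)) (by omega)
    obtain ⟨R₂, hc₂, hR₂⟩ := ih (s \ t) (Finset.card_pos.1 (by omega)) (by omega)
    refine ⟨.alice (fun x => decide (h x ∈ t)) R₁ R₂, ?_, fun x y hx => ?_⟩
    · simp only [Protocol.cost]
      omega
    · by_cases hxt : h x ∈ t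
      · simp [Protocol.eval, hxt, hR₁ x y hxt]
      · simp [Protocol.eval, hxt, hR₂ x y (Finset.mem_sdiff.2 ⟨hx, hxt⟩)]

namespace Protocol

/-- Exchange of the roles of Alice and Bob. -/
def swap {X Y : Type} : Protocol X Y → Protocol Y X
  | leaf out => leaf out
  | alice bit P Q => bob bit P.swap Q.swap
  | bob bit P Q => alice bit P.swap Q.swap

theorem eval_swap {X Y : Type} (P : Protocol X Y) (x : X) (y : Y) :
    P.swap.eval y x = P.eval x y := by
  induction P with
  | leaf => rfl
  | alice _ _ _ ihP ihQ => simp [swap, eval, ihP, ihQ]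
  | bob _ _ _ ihP ihQ => simp [swap, eval, ihP, ihQ]

theorem cost_swap {X Y : Type} (P : Protocol X Y) : P.swap.cost = P.cost := by
  induction P with
  | leaf => rfl
  | alice _ _ _ ihP ihQ => simp [swap, cost, ihP, ihQ]
  | bob _ _ _ ihP ihQ => simp [swap, cost, ihP, ihQ]

end Protocol

/-- Bob announces `h y`, one of at most `2 ^ k` values, at a cost of `k` bits. -/
theorem exists_bobChoose {X Y ι : Type} (h : Y → ι) (P : ι → Protocol X Y) (c : ℕ)
    (hc : ∀ i, (P i).cost ≤ c) (k : ℕ) (s : Finset ι) (hs : s.Nonempty) (hk : s.card ≤ 2 ^ k) :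
    ∃ R : Protocol X Y, R.cost ≤ k + c ∧ ∀ x y, h y ∈ s → R.eval x y = (P (h y)).eval x y := by
  obtain ⟨R, hR, hR'⟩ := exists_aliceChoose h (fun i => (P i).swap) c
    (fun i => by rw [Protocol.cost_swap]; exact hc i) k s hs hk
  refine ⟨R.swap, by rwa [Protocol.cost_swap], fun x y hy => ?_⟩
  rw [Protocol.eval_swap, hR' y x hy, Protocol.eval_swap]

theorem D_le_cost {X Y : Type} {f : X → Y → Bool} {P : Protocol X Y} (hP : P.Computes f) :
    D f ≤ P.cost :=
  Nat.sInf_le ⟨P, hP, rfl⟩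

/-! ### Ranks of submatrices with a zero block -/

open Module

/-- The span of the rows in `S` of the matrix `M`, with the entries outside of `T` replaced
by `0`. -/
noncomputable def rowSpan {X Y : Type} (M : X → Y → ℝ) (S : Set X) (T : Set Y) :
    Submodule ℝ (Y → ℝ) :=
  Submodule.span ℝ ((fun x => T.indicator (M x)) '' S)

/-- Restriction to `B`, as a linear map. -/
noncomputable def restrictTo {Y : Type} (B : Set Y) : (Y → ℝ) →ₗ[ℝ] (Y → ℝ) where
  toFun v := B.indicator v
  map_add' v w := Set.indicator_add B v w
  map_smul' c v := Set.indicator_const_smul B c v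

theorem map_restrictTo_rowSpan {X Y : Type} (M : X → Y → ℝ) (S : Set X) (T B : Set Y) :
    (rowSpan M S T).map (restrictTo B) = rowSpan M S (B ∩ T) := by
  rw [rowSpan, rowSpan, Submodule.map_span, Set.image_image]
  simp only [restrictTo, LinearMap.coe_mk, AddHom.coe_mk, Set.indicator_indicator]

/-- Rank-nullity for the restriction to `B`: its image is the second span on the left, and the rows
in `A`, vanishing on `B`, lie in its kernel. -/
theorem finrank_rowSpan_add_le {X Y : Type} [Finite Y] (M : X → Y → ℝ) (S A : Set X)
    (T B : Set Y) (h0 : ∀ x ∈ A, ∀ y ∈ B, M x y = 0) :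
    finrank ℝ (rowSpan M (A ∩ S) T) + finrank ℝ (rowSpan M S (B ∩ T)) ≤
      finrank ℝ (rowSpan M S T) := by
  have hrn := ((restrictTo B).domRestrict (rowSpan M S T)).finrank_range_add_finrank_ker
  rw [LinearMap.range_domRestrict, map_restrictTo_rowSpan] at hrn
  rw [← hrn, add_comm]
  gcongr
  have hle : rowSpan M (A ∩ S) T ≤ rowSpan M S T :=
    Submodule.span_mono (Set.image_mono Set.inter_subset_right)
  have hker : rowSpan M (A ∩ S) T ≤ LinearMap.ker (restrictTo B) := by
    refine Submodule.span_le.2 ?_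
    rintro _ ⟨x, hx, rfl⟩
    rw [SetLike.mem_coe, LinearMap.mem_ker]
    ext y
    by_cases hy : y ∈ B
    · by_cases hyT : y ∈ T <;> simp [restrictTo, hy, hyT, h0 x hx.1 y hy]
    · simp [restrictTo, hy]
  refine LinearMap.finrank_le_finrank_of_injective
    (f := LinearMap.codRestrict _ (Submodule.inclusion hle) fun v => ?_) fun v w hvw => ?_
  · rw [LinearMap.mem_ker, LinearMap.domRestrict_apply]
    exact hker v.2
  · exact Subtype.ext (congrArg (fun u => (u.1.1 : Y → ℝ)) hvw)

/-! ### Deterministic protocols from covers by monochromatic rectangles -/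

/-- A function with a cover of its ones by `2 ^ k` rectangles `A i × B i` whose complement has rank
less than `2 ^ j` on `S × T` has a protocol of cost `j * (k + 2)` on `S × T`. -/
theorem exists_protocol_of_cover {X Y ι : Type} [Finite Y] [Fintype ι] (f : X → Y → Bool)
    (A : ι → Set X) (B : ι → Set Y) (hAB : ∀ i, ∀ x ∈ A i, ∀ y ∈ B i, f x y = true)
    (hcover : ∀ x y, f x y = true → ∃ i, x ∈ A i ∧ y ∈ B i)
    (k : ℕ) (hk : Fintype.card ι ≤ 2 ^ k) (j : ℕ) (S : Set X) (T : Set Y)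
    (hrank : finrank ℝ (rowSpan (fun x y => if f x y then (0 : ℝ) else 1) S T) < 2 ^ j) :
    ∃ P : Protocol X Y, P.cost ≤ j * (k + 2) ∧ ∀ x ∈ S, ∀ y ∈ T, P.eval x y = f x y := by
  classical
  induction j generalizing S T with
  | zero =>
    refine ⟨.leaf true, by simp [Protocol.cost], fun x hx y hy => ?_⟩
    have h0 : rowSpan (fun x y => if f x y then (0 : ℝ) else 1) S T = ⊥ :=
      Submodule.finrank_eq_zero.1 (by simpa using hrank)
    have h1 : T.indicator (fun y => if f x y then (0 : ℝ) else 1) ∈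
        rowSpan (fun x y => if f x y then (0 : ℝ) else 1) S T :=
      Submodule.subset_span ⟨x, hx, rfl⟩
    rw [h0, Submodule.mem_bot] at h1
    have h2 := congrFun h1 y
    cases hf : f x y with
    | true => rfl
    | false => simp [hy, hf] at h2
  | succ j ih =>
    set M : X → Y → ℝ := fun x y => if f x y then (0 : ℝ) else 1 with hM
    -- The two ranks add up to less than `2 ^ (j + 1)`, so one of them is below `2 ^ j`.
    have hsplit : ∀ i, finrank ℝ (rowSpan M (A i ∩ S) T) < 2 ^ j ∨
        finrank ℝ (rowSpan M S (B i ∩ T)) < 2 ^ j := by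
      intro i
      have := finrank_rowSpan_add_le M S (A i) T (B i) fun x hx y hy => by
        simp [hM, hAB i x hx y hy]
      rw [pow_succ] at hrank
      omega
    rcases isEmpty_or_nonempty ι with hι | ⟨⟨i₀⟩⟩
    · refine ⟨.leaf false, by simp [Protocol.cost], fun x _ y _ => ?_⟩
      cases hf : f x y with
      | false => rfl
      | true => exact (hι.false (hcover x y hf).choose).elim
    have hP : ∀ i, ∃ P : Protocol X Y, P.cost ≤ j * (k + 2) ∧
        (finrank ℝ (rowSpan M (A i ∩ S) T) < 2 ^ j →
          ∀ x ∈ A i ∩ S, ∀ y ∈ T, P.eval x y = f x y) := by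
      intro i
      by_cases hi : finrank ℝ (rowSpan M (A i ∩ S) T) < 2 ^ j
      · obtain ⟨P, hc, hP⟩ := ih _ _ hi
        exact ⟨P, hc, fun _ => hP⟩
      · exact ⟨.leaf true, by simp [Protocol.cost], fun h => absurd h hi⟩
    have hQ : ∀ i, ∃ P : Protocol X Y, P.cost ≤ j * (k + 2) ∧
        (finrank ℝ (rowSpan M S (B i ∩ T)) < 2 ^ j →
          ∀ x ∈ S, ∀ y ∈ B i ∩ T, P.eval x y = f x y) := by
      intro i
      by_cases hi : finrank ℝ (rowSpan M S (B i ∩ T)) < 2 ^ j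
      · obtain ⟨P, hc, hP⟩ := ih _ _ hi
        exact ⟨P, hc, fun _ => hP⟩
      · exact ⟨.leaf true, by simp [Protocol.cost], fun h => absurd h hi⟩
    choose P hPc hP using hP
    choose Q hQc hQ using hQ
    -- Alice looks for a rectangle that contains her row and whose rows have small rank; failing
    -- that, Bob looks on the column side. If both fail, no rectangle covers `(x, y)`, so the value
    -- is `false`. The two flags and the index make up the `k + 2` bits per level.
    let p : X → Prop := fun x => ∃ i, finrank ℝ (rowSpan M (A i ∩ S) T) < 2 ^ j ∧ x ∈ A i
    let q : Y → Prop := fun y => ∃ i, finrank ℝ (rowSpan M S (B i ∩ T)) < 2 ^ j ∧ y ∈ B i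
    obtain ⟨R₁, hc₁, hR₁⟩ := exists_aliceChoose (fun x => if h : p x then h.choose else i₀) P _ hPc k
      Finset.univ ⟨i₀, Finset.mem_univ _⟩ hk
    obtain ⟨R₂, hc₂, hR₂⟩ := exists_bobChoose (fun y => if h : q y then h.choose else i₀) Q _ hQc k
      Finset.univ ⟨i₀, Finset.mem_univ _⟩ hk
    refine ⟨.alice (fun x => decide (p x)) R₁ (.bob (fun y => decide (q y)) R₂ (.leaf false)),
      ?_, fun x hx y hy => ?_⟩
    · simp only [Protocol.cost, add_mul]
      omega
    by_cases hpx : p x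
    · simp only [Protocol.eval, hpx, decide_true, cond_true]
      rw [hR₁ x y (Finset.mem_univ _), dif_pos hpx]
      exact hP _ hpx.choose_spec.1 x ⟨hpx.choose_spec.2, hx⟩ y hy
    by_cases hqy : q y
    · simp only [Protocol.eval, hpx, hqy, decide_true, decide_false, cond_true, cond_false]
      rw [hR₂ x y (Finset.mem_univ _), dif_pos hqy]
      exact hQ _ hqy.choose_spec.1 x hx y ⟨hqy.choose_spec.2, hy⟩
    simp only [Protocol.eval, hpx, hqy, decide_false, cond_false]
    cases hf : f x y with
    | false => rfl
    | true =>
      obtain ⟨i, hxi, hyi⟩ := hcover x y hf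
      rcases hsplit i with h | h
      · exact absurd ⟨i, h, hxi⟩ hpx
      · exact absurd ⟨i, h, hyi⟩ hqy

/-- The complement of `f` has rank at most `rank f + 1`. -/
theorem finrank_rowSpan_compl_le {X Y : Type} [Finite X] [Fintype Y] (f : X → Y → Bool) :
    finrank ℝ (rowSpan (fun x y => if f x y then (0 : ℝ) else 1) Set.univ Set.univ) ≤
      rank f + 1 := by
  have hle : rowSpan (fun x y => if f x y then (0 : ℝ) else 1) Set.univ Set.univ ≤
      Submodule.span ℝ (Set.range (Matrix.of fun x y => if f x y then (1 : ℝ) else 0).row) ⊔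
        Submodule.span ℝ {1} := by
    refine Submodule.span_le.2 ?_
    rintro _ ⟨x, -, rfl⟩
    have : (Set.univ.indicator fun y => if f x y then (0 : ℝ) else 1) =
        -(Matrix.of fun x y => if f x y then (1 : ℝ) else 0).row x + 1 := by
      ext y
      cases h : f x y <;> simp [h]
    rw [SetLike.mem_coe]
    change (Set.univ.indicator fun y => if f x y then (0 : ℝ) else 1) ∈ _
    rw [this]
    exact Submodule.add_mem_sup (Submodule.neg_mem _ (Submodule.subset_span ⟨x, rfl⟩))
      (Submodule.mem_span_singleton_self _)
  refine (Submodule.finrank_mono hle).trans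
    ((Submodule.finrank_add_le_finrank_add_finrank _ _).trans ?_)
  rw [rank, Matrix.rank_eq_finrank_span_row]
  gcongr
  simpa using finrank_span_le_card (R := ℝ) ({1} : Set (Y → ℝ))

/-! ### Minterms -/

/-- The minterms of `g`: the minimal inputs on which `g` is true. -/
def IsMinterm {n : ℕ} (g : Bits n → Bool) (z : Bits n) : Prop :=
  Minimal (fun w => g w = true) z

theorem andFun_eq_true_iff {n : ℕ} {g : Bits n → Bool} (hg : Monotone g) (x y : Bits n) :
    andFun g x y = true ↔ ∃ z, IsMinterm g z ∧ z ≤ x ∧ z ≤ y := by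
  have hinf : andFun g x y = g (x ⊓ y) := rfl
  rw [hinf]
  constructor
  · intro h
    obtain ⟨z, hz, hmin⟩ := exists_minimal_le_of_wellFoundedLT (fun w => g w = true) _ h
    exact ⟨z, hmin, le_inf_iff.1 hz⟩
  · rintro ⟨z, hz, hx, hy⟩
    have h := hg (le_inf hx hy)
    rw [show g z = true from hz.prop] at h
    exact top_le_iff.1 h

open Classical in
-- A minterm below two minterms equals both, so the submatrix indexed by minterms is the identity.
theorem card_minterm_le_rank {n : ℕ} {g : Bits n → Bool} (hg : Monotone g) :
    Fintype.card {z // IsMinterm g z} ≤ rank (andFun g) := by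
  have h : (Matrix.of fun x y => if andFun g x y then (1 : ℝ) else 0).submatrix
      (Subtype.val : {z // IsMinterm g z} → _) (Subtype.val : {z // IsMinterm g z} → _) = 1 := by
    ext z w
    rw [Matrix.one_apply]
    simp only [Matrix.submatrix_apply, Matrix.of_apply]
    congr 1
    rw [andFun_eq_true_iff hg, eq_iff_iff]
    constructor
    · rintro ⟨u, hu, hz, hw⟩
      exact Subtype.ext ((z.2.eq_of_le hu.prop hz).symm.trans (w.2.eq_of_le hu.prop hw))
    · rintro rfl
      exact ⟨z, z.2, le_rfl, le_rfl⟩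
  have h1 := Matrix.rank_submatrix_le (Matrix.of fun x y => if andFun g x y then (1 : ℝ) else 0)
    (Subtype.val : {z // IsMinterm g z} → _) (Subtype.val : {z // IsMinterm g z} → _)
  rwa [h, Matrix.rank_one] at h1

theorem D_andFun_le {n : ℕ} {g : Bits n → Bool} (hg : Monotone g) (j : ℕ)
    (hj : rank (andFun g) + 1 < 2 ^ j) : D (andFun g) ≤ j * (j + 2) := by
  classical
  have hk : Fintype.card {z // IsMinterm g z} ≤ 2 ^ j := (card_minterm_le_rank hg).trans (by omega)
  obtain ⟨P, hc, hP⟩ := exists_protocol_of_cover (ι := {z // IsMinterm g z}) (andFun g)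
    (fun z => Set.Ici z.1) (fun z => Set.Ici z.1)
    (fun z x hx y hy => (andFun_eq_true_iff hg x y).2 ⟨z.1, z.2, hx, hy⟩)
    (fun x y hxy => by
      obtain ⟨z, hz, h⟩ := (andFun_eq_true_iff hg x y).1 hxy
      exact ⟨⟨z, hz⟩, h⟩)
    j hk j Set.univ Set.univ ((finrank_rowSpan_compl_le _).trans_lt hj)
  exact (D_le_cost fun x y => hP x (Set.mem_univ x) y (Set.mem_univ y)).trans hc

theorem D_andFun_le_logb {n : ℕ} {g : Bits n → Bool} (hg : Monotone g) :
    (D (andFun g) : ℝ) ≤ 15 * max 1 (Real.logb 2 (rank (andFun g)) ^ 2) := by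
  set r := rank (andFun g) with hr
  set j := Nat.log 2 (r + 1) with hj
  have hD : D (andFun g) ≤ (j + 1) * (j + 1 + 2) :=
    D_andFun_le hg (j + 1) (Nat.lt_pow_succ_log_self (by norm_num) _)
  have hD' : (D (andFun g) : ℝ) ≤ (j + 1) * (j + 1 + 2) := by exact_mod_cast hD
  rcases Nat.eq_zero_or_pos r with h0 | h0
  · have : j = 0 := by simp [hj, h0]
    rw [this] at hD
    have h3 : (D (andFun g) : ℝ) ≤ 3 := by exact_mod_cast hD
    linarith [le_max_left 1 (Real.logb 2 r ^ 2)]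
  have hjl : (j : ℝ) ≤ Real.logb 2 r + 1 := by
    have h1 : 2 ^ j ≤ 2 * r := (Nat.pow_log_le_self 2 (by omega)).trans (by omega)
    have h2 : (2 : ℝ) ^ (j : ℝ) ≤ 2 * r := by rw [Real.rpow_natCast]; exact_mod_cast h1
    have hr0 : (0 : ℝ) < r := by exact_mod_cast h0
    have h3 := (Real.le_logb_iff_rpow_le (by norm_num) (by positivity)).2 h2
    rw [Real.logb_mul (by norm_num) hr0.ne', Real.logb_self_eq_one (by norm_num)] at h3
    linarith
  have hL : 0 ≤ Real.logb 2 r := Real.logb_nonneg (by norm_num) (by exact_mod_cast h0)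
  generalize Real.logb 2 r = L at *
  have hj0 : (0 : ℝ) ≤ j := by positivity
  -- The constant 15 is the value of this product at `L = 1`; for `L ≥ 1` the product is at most `3L
  -- * 5L`.
  have : (D (andFun g) : ℝ) ≤ (L + 2) * (L + 4) := hD'.trans (by nlinarith)
  rcases le_total L 1 with h | h
  · have := le_max_left 1 (L ^ 2)
    nlinarith
  · have := le_max_right 1 (L ^ 2)
    nlinarith

open scoped Kronecker

/-! ### A rank bound from factorizations through scalar matrices -/

theorem exists_mul_mul_eq_one {m : Type} [Fintype m] [DecidableEq m] (M : Matrix m m ℝ) :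
    ∃ (A : Matrix (Fin M.rank) m ℝ) (B : Matrix m (Fin M.rank) ℝ), A * M * B = 1 := by
  obtain ⟨V, U, e, -, -, h⟩ := M.exists_rank_normal_form
  refine ⟨V.submatrix (fun i => e.symm (Sum.inl i)) id, U.submatrix id fun i => e.symm (Sum.inl i),
    ?_⟩
  ext i k
  change (V * M * U) (e.symm (Sum.inl i)) (e.symm (Sum.inl k)) = _
  simp [h]

/-- If the matrices `M x y • 1` are sums of `card W` products of a matrix that depends on `x` and
one that depends on `y`, then `M` has rank at most `card W`. -/
theorem rank_le_card_of_smul_one_eq_sum {m d W : Type} [Fintype m] [DecidableEq m] [Fintype d]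
    [DecidableEq d] [Nonempty d] [Fintype W] (M : Matrix m m ℝ) (P Q : W → m → Matrix d d ℂ)
    (h : ∀ x y, ((M x y : ℝ) : ℂ) • (1 : Matrix d d ℂ) = ∑ w, P w x * Q w y) :
    M.rank ≤ Fintype.card W := by
  obtain ⟨A, B, hAB⟩ := exists_mul_mul_eq_one M
  -- The identity `A * M * B = 1` survives the passage to ℂ, so real and complex ranks need not be
  -- compared.
  have hC : A.map Complex.ofRealHom * M.map Complex.ofRealHom * B.map Complex.ofRealHom = 1 := by
    rw [← Matrix.map_mul, ← Matrix.map_mul, hAB, Matrix.map_one _ (map_zero _) (map_one _)]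
  let P' : Matrix (m × d) (W × d) ℂ := Matrix.of fun p q => P q.1 p.1 p.2 q.2
  let Q' : Matrix (W × d) (m × d) ℂ := Matrix.of fun p q => Q p.1 q.1 p.2 q.2
  have hPQ : M.map Complex.ofRealHom ⊗ₖ (1 : Matrix d d ℂ) = P' * Q' := by
    ext ⟨x, u⟩ ⟨y, v⟩
    have := congrFun (congrFun (h x y) u) v
    simp only [Matrix.smul_apply, Matrix.sum_apply, Matrix.mul_apply, smul_eq_mul] at this
    rw [Matrix.mul_apply, Fintype.sum_prod_type]
    exact this
  have hone : (A.map Complex.ofRealHom ⊗ₖ (1 : Matrix d d ℂ)) * P' *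
      (Q' * (B.map Complex.ofRealHom ⊗ₖ (1 : Matrix d d ℂ))) = 1 := by
    rw [← Matrix.mul_assoc, Matrix.mul_assoc _ P', ← hPQ, ← Matrix.mul_kronecker_mul,
      ← Matrix.mul_kronecker_mul, hC, one_mul, one_mul, Matrix.one_kronecker_one]
  -- An identity matrix of size `M.rank * card d` factors through dimension `card W * card d`.
  have h1 := (Matrix.rank_mul_le_left ((A.map Complex.ofRealHom ⊗ₖ (1 : Matrix d d ℂ)) * P')
    (Q' * (B.map Complex.ofRealHom ⊗ₖ (1 : Matrix d d ℂ)))).trans (Matrix.rank_le_card_width _)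
  rw [hone, Matrix.rank_one, Fintype.card_prod, Fintype.card_prod,
    Fintype.card_fin] at h1
  exact Nat.le_of_mul_le_mul_right h1 Fintype.card_pos

/-! ### Decomposition of the states of a qubit protocol -/

/-- The states `ψ x y` are, for each value of the channel, sums of `N` terms, each of which
is obtained from the `2 ^ k`-dimensional maximally entangled state by an operator of Alice that
depends on `x` and one of Bob that depends on `y`. -/
def HasDecomposition {X Y : Type} {k a b : ℕ} (N : ℕ) (ψ : X → Y → State k a b) : Prop :=
  ∃ (W : Type) (_ : Fintype W) (P : W → Bool → X → Reg k a → Bits k → ℂ)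
    (Q : W → Bool → Y → Bits k → Reg k b → ℂ), Fintype.card W = N ∧
      ∀ x y r c s, ψ x y (r, c, s) = ∑ w, ∑ u, P w c x r u * Q w c y u s

namespace HasDecomposition

variable {X Y : Type} {k a b N : ℕ} {ψ : X → Y → State k a b}

theorem init : HasDecomposition (X := X) (Y := Y) 1 fun _ _ => initState k a b := by
  refine ⟨Unit, inferInstance,
    fun _ c _ r u => if r.1 = u ∧ r.2 = (fun _ => false) ∧ c = false then 1 else 0,
    fun _ _ _ u s => if s.1 = u ∧ s.2 = (fun _ => false) then (((Real.sqrt 2)⁻¹ : ℝ) : ℂ) ^ k else 0,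
    by simp, fun x y r c s => ?_⟩
  rw [Fintype.sum_unique, Fintype.sum_eq_single r.1]
  · simp only [initState, true_and]
    by_cases h1 : r.1 = s.1 <;> by_cases h2 : r.2 = (fun _ => false) <;>
      by_cases h3 : c = false <;> by_cases h4 : s.2 = (fun _ => false) <;>
      simp [h1, h2, h3, h4, eq_comm (a := s.1)]
  · intro u hu
    simp [hu.symm]

/-- The sum over the incoming channel value joins the index set, which doubles it; the sum over
Alice's register is absorbed into her operator. -/
theorem applyAlice (h : HasDecomposition N ψ)
    (U : X → Matrix (Reg k a × Bool) (Reg k a × Bool) ℂ) :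
    HasDecomposition (N * 2) fun x y => CommComplexity.applyAlice (U x) (ψ x y) := by
  obtain ⟨W, _, P, Q, hW, hψ⟩ := h
  refine ⟨W × Bool, inferInstance,
    fun w c x r u => ∑ r', U x (r, c) (r', w.2) * P w.1 w.2 x r' u,
    fun w _ y u s => Q w.1 w.2 y u s, by simp [hW], fun x y r c s => ?_⟩
  simp only [CommComplexity.applyAlice, Matrix.mulVec, dotProduct, hψ, Finset.mul_sum,
    Finset.sum_mul, Fintype.sum_prod_type_right (α₁ := Reg k a),
    Fintype.sum_prod_type_right (α₁ := W)]
  refine Finset.sum_congr rfl fun c' _ => ?_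
  rw [Finset.sum_comm]
  refine Finset.sum_congr rfl fun w _ => ?_
  rw [Finset.sum_comm]
  simp only [mul_assoc]

theorem applyBob (h : HasDecomposition N ψ)
    (V : Y → Matrix (Bool × Reg k b) (Bool × Reg k b) ℂ) :
    HasDecomposition (N * 2) fun x y => CommComplexity.applyBob (V y) (ψ x y) := by
  obtain ⟨W, _, P, Q, hW, hψ⟩ := h
  refine ⟨W × Bool, inferInstance, fun w _ x r u => P w.1 w.2 x r u,
    fun w c y u s => ∑ s', V y (c, s) (w.2, s') * Q w.1 w.2 y u s',
    by simp [hW], fun x y r c s => ?_⟩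
  simp only [CommComplexity.applyBob, Matrix.mulVec, dotProduct, hψ, Finset.mul_sum,
    Fintype.sum_prod_type (α₁ := Bool), Fintype.sum_prod_type_right (α₁ := W)]
  refine Finset.sum_congr rfl fun c' _ => ?_
  rw [Finset.sum_comm]
  refine Finset.sum_congr rfl fun w _ => ?_
  rw [Finset.sum_comm]
  simp only [mul_left_comm]

theorem project (h : HasDecomposition N ψ) :
    HasDecomposition N fun x y p => if p.2.1 then ψ x y p else 0 := by
  obtain ⟨W, _, P, Q, hW, hψ⟩ := h
  refine ⟨W, inferInstance, fun w c x r u => if c then P w c x r u else 0, Q, hW,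
    fun x y r c s => ?_⟩
  cases c <;> simp [hψ]

theorem evolve (U : ℕ → X → Matrix.unitaryGroup (Reg k a × Bool) ℂ)
    (V : ℕ → Y → Matrix.unitaryGroup (Bool × Reg k b) ℂ) (i : ℕ) :
    HasDecomposition (2 ^ i) fun x y =>
      CommComplexity.evolve (fun j => U j x) (fun j => V j y) i := by
  induction i with
  | zero => exact init
  | succ i ih =>
    by_cases hi : Even i
    · simp only [CommComplexity.evolve, if_pos hi]
      exact ih.applyAlice fun x => (U i x).1
    · simp only [CommComplexity.evolve, if_neg hi]
      exact ih.applyBob fun y => (V i y).1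

end HasDecomposition

/-- The scalar `c` will be `f x y`, which has to be carried through while the rounds are undone. -/
theorem applyAlice_star_apply {k a b : ℕ} (U : Matrix.unitaryGroup (Reg k a × Bool) ℂ) (c : ℂ)
    (ψ : State k a b) : applyAlice (star U.1) (c • applyAlice U.1 ψ) = c • ψ := by
  ext ⟨r, e, s⟩
  change (star U.1).mulVec (c • U.1.mulVec fun q => ψ (q.1, q.2, s)) (r, e) = _
  rw [Matrix.mulVec_smul, Matrix.mulVec_mulVec, Matrix.UnitaryGroup.star_mul_self,
    Matrix.one_mulVec]
  rfl

theorem applyBob_star_apply {k a b : ℕ} (V : Matrix.unitaryGroup (Bool × Reg k b) ℂ) (c : ℂ)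
    (ψ : State k a b) : applyBob (star V.1) (c • applyBob V.1 ψ) = c • ψ := by
  ext ⟨r, q⟩
  change (star V.1).mulVec (c • V.1.mulVec fun q => ψ (r, q)) q = _
  rw [Matrix.mulVec_smul, Matrix.mulVec_mulVec, Matrix.UnitaryGroup.star_mul_self,
    Matrix.one_mulVec]
  rfl

/-- Running the protocol backwards. -/
theorem HasDecomposition.smul_init {X Y : Type} {k a b N : ℕ} (f : X → Y → ℂ)
    (U : ℕ → X → Matrix.unitaryGroup (Reg k a × Bool) ℂ)
    (V : ℕ → Y → Matrix.unitaryGroup (Bool × Reg k b) ℂ) (i : ℕ)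
    (h : HasDecomposition N fun x y =>
      f x y • CommComplexity.evolve (fun j => U j x) (fun j => V j y) i) :
    HasDecomposition (N * 2 ^ i) fun x y => f x y • initState k a b := by
  induction i generalizing N with
  | zero => simpa only [CommComplexity.evolve, pow_zero, mul_one] using h
  | succ i ih =>
    rw [pow_succ', ← mul_assoc]
    apply ih
    by_cases hi : Even i
    · simp only [CommComplexity.evolve, if_pos hi] at h
      simpa only [applyAlice_star_apply] using h.applyAlice fun x => star (U i x).1
    · simp only [CommComplexity.evolve, if_neg hi] at h
      simpa only [applyBob_star_apply] using h.applyBob fun y => star (V i y).1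

/-! ### The norm of the states -/

theorem sum_norm_sq_unitary_mulVec {ι : Type} [Fintype ι] [DecidableEq ι]
    (U : Matrix.unitaryGroup ι ℂ) (v : ι → ℂ) : ∑ p, ‖U.1.mulVec v p‖ ^ 2 = ∑ p, ‖v p‖ ^ 2 := by
  have key : ∀ w : ι → ℂ, ((∑ p, ‖w p‖ ^ 2 : ℝ) : ℂ) = star w ⬝ᵥ w := by
    intro w
    simp [dotProduct, Complex.conj_mul']
  apply Complex.ofReal_injective
  rw [key, key, Matrix.star_mulVec, Matrix.dotProduct_mulVec, Matrix.vecMul_vecMul,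
    ← Matrix.star_eq_conjTranspose, Matrix.UnitaryGroup.star_mul_self, Matrix.vecMul_one]

theorem sum_norm_sq_initState (k a b : ℕ) :
    ∑ r, ∑ c, ∑ s, ‖initState k a b (r, c, s)‖ ^ 2 = 1 := by
  have h : ∀ r c s, ‖initState k a b (r, c, s)‖ ^ 2 =
      if r.1 = s.1 ∧ r.2 = (fun _ => false) ∧ c = false ∧ s.2 = (fun _ => false)
      then (2⁻¹ : ℝ) ^ k else 0 := by
    intro r c s
    simp only [initState]
    split_ifs
    · rw [norm_pow, Complex.norm_real, ← pow_mul, mul_comm, pow_mul]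
      simp
    · simp
  simp_rw [h, Fintype.sum_prod_type, Fintype.sum_bool]
  simp only [Bool.true_eq_false, false_and, and_false, if_false, Finset.sum_const_zero, zero_add,
    true_and, ite_and]
  simp

theorem sum_norm_sq_evolve {k a b : ℕ} (U : ℕ → Matrix.unitaryGroup (Reg k a × Bool) ℂ)
    (V : ℕ → Matrix.unitaryGroup (Bool × Reg k b) ℂ) (i : ℕ) :
    ∑ r, ∑ c, ∑ s, ‖evolve U V i (r, c, s)‖ ^ 2 = 1 := by
  induction i with
  | zero => exact sum_norm_sq_initState k a b
  | succ i ih =>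
    rw [← ih, evolve]
    split_ifs with hi
    · have h := fun s => sum_norm_sq_unitary_mulVec (U i) fun q => evolve U V i (q.1, q.2, s)
      simp only [Fintype.sum_prod_type (α₂ := Bool)] at h
      have comm : ∀ F : Reg k a → Bool → Reg k b → ℝ,
          ∑ r, ∑ c, ∑ s, F r c s = ∑ s, ∑ r, ∑ c, F r c s := by
        intro F
        simp only [Finset.sum_comm (s := (Finset.univ : Finset (Reg k b)))]
      rw [comm, comm]
      exact Finset.sum_congr rfl fun s _ => h s
    · have h := fun r => sum_norm_sq_unitary_mulVec (V i) fun q => evolve U V i (r, q)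
      simp only [Fintype.sum_prod_type (α₁ := Bool)] at h
      exact Finset.sum_congr rfl fun r _ => h r

/-! ### The rank bound for exact protocols and the bound by `Qstar` -/

namespace QProtocol

variable {X Y : Type}

/-- The state has norm 1 and the correct channel value already has probability 1, which leaves no
weight for the other. -/
theorem finalState_eq_zero {π : QProtocol X Y} {f : X → Y → Bool} (hπ : π.Computes f) (x : X)
    (y : Y) (r : Reg π.epr π.anc₁) (c : Bool) (s : Reg π.epr π.anc₂) (hc : c ≠ f x y) :
    π.finalState x y (r, c, s) = 0 := by
  have h1 := sum_norm_sq_evolve (fun i => π.alice i x) (fun i => π.bob i y) π.rounds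
  have h2 : π.outputProb x y (f x y) + π.outputProb x y c = 1 := by
    rw [← h1, outputProb, outputProb, ← Finset.sum_add_distrib]
    refine Finset.sum_congr rfl fun r _ => ?_
    have hsum : ∀ F : Bool → ℝ, F (f x y) + F c = ∑ e, F e := by
      intro F
      rw [Fintype.sum_bool]
      obtain rfl : c = !f x y := Bool.eq_not.2 hc
      cases f x y
      · exact add_comm _ _
      · rfl
    exact hsum fun e => ∑ s, ‖π.finalState x y (r, e, s)‖ ^ 2
  rw [hπ x y] at h2
  have h3 : π.outputProb x y c = 0 := by linarith
  rw [outputProb, Finset.sum_eq_zero_iff_of_nonneg fun _ _ => by positivity] at h3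
  have h4 := h3 r (Finset.mem_univ r)
  rw [Finset.sum_eq_zero_iff_of_nonneg fun _ _ => by positivity] at h4
  simpa using h4 s (Finset.mem_univ s)

/-- An exact qubit protocol with `ℓ` rounds for `f` shows that `rank f ≤ 4 ^ ℓ`, however many
EPR-pairs it uses. -/
theorem rank_le {X : Type} [Fintype X] [DecidableEq X] {π : QProtocol X X} {f : X → X → Bool}
    (hπ : π.Computes f) : rank f ≤ 4 ^ π.rounds := by
  have h := (HasDecomposition.evolve π.alice π.bob π.rounds).project
  have hproj : (fun x y (p : Reg π.epr π.anc₁ × Bool × Reg π.epr π.anc₂) =>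
      if p.2.1 then evolve (fun j => π.alice j x) (fun j => π.bob j y) π.rounds p else 0) =
      fun x y => (((if f x y then (1 : ℝ) else 0) : ℝ) : ℂ) •
        evolve (fun j => π.alice j x) (fun j => π.bob j y) π.rounds := by
    funext x y ⟨r, c, s⟩
    have h0 := finalState_eq_zero hπ x y r c s
    rw [finalState] at h0
    by_cases hc : c = f x y
    · cases c <;> simp [← hc]
    · simp [h0 hc]
  rw [hproj] at h
  obtain ⟨W, _, P, Q, hW, hψ⟩ := HasDecomposition.smul_init _ _ _ _ h
  rw [show (4 : ℕ) = 2 * 2 from rfl, mul_pow, ← hW]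
  have hs : (((Real.sqrt 2)⁻¹ : ℝ) : ℂ) ^ π.epr ≠ 0 := by simp
  refine rank_le_card_of_smul_one_eq_sum _
    (fun w x => ((((Real.sqrt 2)⁻¹ : ℝ) : ℂ) ^ π.epr)⁻¹ •
      Matrix.of fun v u : Bits π.epr => P w false x (v, fun _ => false) u)
    (fun w y => Matrix.of fun u v : Bits π.epr => Q w false y u (v, fun _ => false))
    fun x y => ?_
  -- With the channel and all ancillas at zero, the initial state is a scalar multiple of the
  -- identity matrix on the EPR halves; the scalar was divided out on Alice's side.
  ext v v'
  have h1 := hψ x y (v, fun _ => false) false (v', fun _ => false)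
  simp only [Matrix.sum_apply, Matrix.smul_mul, Matrix.smul_apply, Matrix.mul_apply,
    Matrix.of_apply, smul_eq_mul, ← Finset.mul_sum]
  rw [← h1]
  by_cases hv : v = v'
  · subst hv
    simp only [initState, Pi.smul_apply, smul_eq_mul, and_self, if_true, Matrix.one_apply_eq]
    field_simp
  · simp [initState, hv]

/-- Without communication the channel is never set. -/
theorem eq_false_of_rounds_eq_zero {π : QProtocol X Y} {f : X → Y → Bool} (hπ : π.Computes f)
    (h0 : π.rounds = 0) (x : X) (y : Y) : f x y = false := by
  by_contra hf
  have h := hπ x y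
  rw [Bool.not_eq_false] at hf
  simp [outputProb, finalState, h0, evolve, initState, hf] at h

end QProtocol

theorem exists_rounds_eq_Qstar {n : ℕ} {Y : Type} (f : Bits n → Y → Bool) :
    ∃ π : QProtocol (Bits n) Y, π.Computes f ∧ π.rounds = Qstar f := by
  obtain ⟨π, hπ⟩ := exists_qProtocol f
  exact Nat.sInf_mem (s := {l | ∃ π : QProtocol (Bits n) Y, π.Computes f ∧ π.rounds = l})
    ⟨_, π, hπ, rfl⟩

theorem D_andFun_le_Qstar {n : ℕ} {g : Bits n → Bool} (hg : Monotone g) :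
    (D (andFun g) : ℝ) ≤ 60 * (Qstar (andFun g) : ℝ) ^ 2 := by
  obtain ⟨π, hπ, hr⟩ := exists_rounds_eq_Qstar (andFun g)
  rw [← hr]
  -- The bound has no additive constant, so zero rounds must force `D = 0`. Otherwise `log rank ≤ 2
  -- * rounds`, and the constant is `15 * 4 = 60`.
  rcases Nat.eq_zero_or_pos π.rounds with h0 | h0
  · have h1 : D (andFun g) ≤ (Protocol.leaf false : Protocol (Bits n) (Bits n)).cost :=
      D_le_cost fun x y => (QProtocol.eq_false_of_rounds_eq_zero hπ h0 x y).symm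
    have h2 : D (andFun g) = 0 := Nat.le_zero.1 h1
    rw [h2, Nat.cast_zero]
    positivity
  have hq : (1 : ℝ) ≤ π.rounds := by exact_mod_cast h0
  have hmax : max 1 (Real.logb 2 (rank (andFun g)) ^ 2) ≤ 4 * (π.rounds : ℝ) ^ 2 := by
    refine max_le (by nlinarith) ?_
    rcases Nat.eq_zero_or_pos (rank (andFun g)) with h | h
    · rw [h]
      simp
    · have hpos : (0 : ℝ) < rank (andFun g) := by exact_mod_cast h
      have hle : (rank (andFun g) : ℝ) ≤ 2 ^ ((2 * π.rounds : ℕ) : ℝ) := by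
        rw [Real.rpow_natCast, pow_mul]
        exact_mod_cast QProtocol.rank_le hπ
      have h1 := (Real.logb_le_iff_le_rpow (by norm_num) hpos).2 hle
      have h2 : 0 ≤ Real.logb 2 (rank (andFun g)) :=
        Real.logb_nonneg (by norm_num) (by exact_mod_cast h)
      push_cast at h1
      nlinarith
  linarith [D_andFun_le_logb hg]

end CommComplexity

theorem mainTheorem8 :
    ∃ C : ℝ, 0 < C ∧ ∀ (n : ℕ) (g : (Fin n → Bool) → Bool), Monotone g →
      (CommComplexity.D (CommComplexity.andFun g) : ℝ) ≤
          C * max 1 (Real.logb 2 (CommComplexity.rank (CommComplexity.andFun g)) ^ 2) ∧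
        (CommComplexity.D (CommComplexity.andFun g) : ℝ) ≤
          C * (CommComplexity.Qstar (CommComplexity.andFun g) : ℝ) ^ 2 := by
  refine ⟨60, by norm_num, fun n g hg => ⟨?_, CommComplexity.D_andFun_le_Qstar hg⟩⟩
  refine (CommComplexity.D_andFun_le_logb hg).trans ?_
  gcongr
  norm_num
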